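/- **Setting.** Let $\overline{\mathbb R}=\mathbb R\cup\{-\infty,\infty\}$ and let $\mathbf X$ be a finite set of variables; variable assignments $\rho:\mathbf X\to\overline{\mathbb R}$ are ordered pointwise. For $f:\overline{\mathbb R}^{\mathbf X}\to\overline{\mathbb R}$ and $I:\mathbf X\to\{-\infty,\mathrm{id},\infty\}$ (two constant functions and the identity) put $f^{(I)}(x)=f\big((I(i)(x_i))_{i}\big)$ and $\mathrm{fdom}(f^{(I)})=\{x\in\mathbb R^{\mathbf X}\mid f^{(I)}(x)\in\mathbb R\}$. The map $f$ is *concave* if it is continuous on $\{x\mid f(x)>-\infty\}$ and, for all $I$, the set $\mathrm{fdom}(f^{(I)})$ is convex, $f^{(I)}$ is concave on it, and, if it is non-empty, $f^{(I)}<\infty$ on $\mathbb R^{\mathbf X}$. A *basic concave expression* is a monotone and concave map $\overline{\mathbb R}^{\mathbf X}\to\overline{\mathbb R}$. A *system of concave equations* $\mathcal E$ has one equation $\mathbf x=\bigvee E_{\mathbf x}$ for each $\mathbf x\in\mathbf X$, where $E_{\mathbf x}$ is a non-empty (possibly infinite) family of basic concave expressions; $[\![\mathcal E]\!]$ is the operator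 $\rho\mapsto(\mathbf x\mapsto\sup_{e\in E_{\mathbf x}}e(\rho))$. Solutions satisfy $\rho=[\![\mathcal E]\!]\rho$, pre-solutions $\rho\le[\![\mathcal E]\!]\rho$; $\mu[\![\mathcal E]\!]$ is the least solution and $\mu_{\ge\rho}[\![\mathcal E]\!]$ the least solution $\geq\rho$. A *$\vee$-strategy* $\sigma$ selects one alternative from each join $\bigvee E$ occurring in $\mathcal E$; $\mathcal E(\sigma)$ is the system with only the selected alternatives, and $\Sigma$ is the set of all $\vee$-strategies for $\mathcal E$. For a pre-solution $\rho$ of $\mathcal E(\sigma)$, a strategy $\sigma'$ is an *improvement* of $\sigma$ w.r.t. $\rho$ if (1) $[\![\mathcal E(\sigma')]\!]\rho>\rho$ unless $\rho$ is a solution of $\mathcal E$, and (2) wherever $\sigma'$ selects another alternative than $\sigma$, its value at $\rho$ is strictly larger. A *strategy improvement operator* $P$ assigns an improvement to every such pair $(\sigma,\rho)$. $\mathcal E\vee-\infty$ is the system obtained by adding the constant $-\infty$ to each join as an alternative. The *strategy improvement algorithm* works on $\mathcal E\vee-\infty$ with a given strategy improvement operator $P$ for it. It starts with a strategy $\sigma$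 that selects the constant $-\infty$ for every variable and with $\rho=-\infty$; while $\rho$ is not a solution it performs the improvement step $\sigma:=P(\sigma,\rho)$, $\rho:=\mu_{\ge\rho}[\![(\mathcal E\vee-\infty)(\sigma)]\!]$; then it returns $\rho$. A *greatest finite pre-solution* of $(\mathcal E\vee-\infty)(\sigma)$ is a greatest one among those pre-solutions that are real-valued on all variables whose selected alternative is not the constant $-\infty$ (the others necessarily have the value $-\infty$). *Feasibility.* Let $\mathcal F$ be a system of basic concave equations $\mathbf x=f_{\mathbf x}$. A real-valued solution $\rho$ of $\mathcal F$ is feasible if there are a partition $\mathbf X=\mathbf X_1\,\dot\cup\,\mathbf X_2$ and $k\in\mathbb N$ such that (i) there is $\rho'$ on $\mathbf X_1$, with $\rho'<\rho$ at every variable of $\mathbf X_1$, such that $\rho'\,\dot\cup\,\rho|_{\mathbf X_2}$ is a pre-solution and $\rho=[\![\mathcal F]\!]^k(\rho'\,\dot\cup\,\rho|_{\mathbf X_2})$; (ii) there is $\rho'$ on $\mathbf X_2$ with $\rho'<\rho$ and $\rho'<[\![\mathcal F]\!]^k(\rho|_{\mathbf X_1}\,\dot\cup\,\rho')$ at every variable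 of $\mathbf X_2$. A real-valued pre-solution $\rho$ is feasible if $\mu_{\ge\rho}[\![\mathcal F]\!]$ is a feasible real-valued solution. A pre-solution $\rho$ with all values $<\infty$ is feasible if $f_{\mathbf x}$ is the constant $-\infty$ whenever $f_{\mathbf x}(\rho)=-\infty$, and the restriction of $\rho$ to $\mathbf X'=\{\mathbf x\mid f_{\mathbf x}(\rho)>-\infty\}$ is a feasible real-valued pre-solution of the subsystem for $\mathbf X'$ (with $-\infty$ for the other variables). The system $\mathcal F$ is *feasible* if it has a feasible solution. **Theorem.** Let $\mathcal E$ be a system of concave equations with $\mu[\![\mathcal E]\!](\mathbf x)<\infty$ for all $\mathbf x\in\mathbf X$, and let a procedure be given that returns, for each strategy $\sigma$ for which $(\mathcal E\vee-\infty)(\sigma)$ is feasible, the greatest finite pre-solution $\rho_\sigma$ of $(\mathcal E\vee-\infty)(\sigma)$. Then, for every strategy improvement operator and every initial strategy as above: 1. whenever the strategy improvement algorithm terminates, it returns $\mu[\![\mathcal E]\!]$; 2. it performs at most $|\Sigma|+|\mathbf X|$ strategy improvement steps (no bound is claimed if $\Sigma$ is infinite); 3. if $\Sigma$ is finite, it terminates,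 and so returns $\mu[\![\mathcal E]\!]$ after at most $|\Sigma|+|\mathbf X|$ improvement steps; 4. in each improvement step, with new strategy $\sigma$, the least solution $\mu_{\ge\rho}[\![(\mathcal E\vee-\infty)(\sigma)]\!]$ exists and is the greatest finite pre-solution of $(\mathcal E\vee-\infty)(\sigma)$; if $(\mathcal E\vee-\infty)(\sigma)$ is feasible, it is the result $\rho_\sigma$ of the given procedure. -/

import Mathlib

/-! ### Concave maps on the extended reals -/

/-- The three functions `-∞`, `id`, `∞` on the extended reals that may be applied to an argument. -/
inductive ArgMode where
  | negInf
  | ident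
  | posInf

/-- The function on the extended reals denoted by an `ArgMode`. -/
noncomputable def ArgMode.app : ArgMode → EReal → EReal
  | ArgMode.negInf, _ => ⊥
  | ArgMode.ident, a => a
  | ArgMode.posInf, _ => ⊤

/-- `f^(I) (x₁, …, xₙ) = f (I(1)(x₁), …, I(n)(xₙ))`. -/
noncomputable def substArgs {X : Type*} (f : (X → EReal) → EReal) (I : X → ArgMode) : (X → EReal) → EReal :=
  fun x => f (fun i => (I i).app (x i))

/-- A real vector, regarded as a vector of extended reals. -/
def realVec {X : Type*} (x : X → ℝ) : X → EReal := fun i => (x i : EReal)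

/-- The real vectors at which `f` takes a real value. -/
def fdom {X : Type*} (f : (X → EReal) → EReal) : Set (X → ℝ) :=
  {x | f (realVec x) ≠ ⊥ ∧ f (realVec x) ≠ ⊤}

/-- Concavity of a map from vectors of extended reals to the extended reals.
(`ConcaveOn` contains the convexity of the domain.) -/
def IsConcaveMap {X : Type*} (f : (X → EReal) → EReal) : Prop :=
  ContinuousOn f {x | ⊥ < f x} ∧
    ∀ I : X → ArgMode,
      ConcaveOn ℝ (fdom (substArgs f I)) (fun x => (substArgs f I (realVec x)).toReal) ∧
      ((fdom (substArgs f I)).Nonempty → ∀ x : X → ℝ, substArgs f I (realVec x) < ⊤)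

/-! ### Fixpoints of operators on variable assignments -/

/-- Variable assignments that solve `ρ = F ρ`. -/
def solutions {X : Type*} (F : (X → EReal) → X → EReal) : Set (X → EReal) := {ρ | F ρ = ρ}

/-- Pre-solutions `ρ ≤ F ρ`. -/
def preSolutions {X : Type*} (F : (X → EReal) → X → EReal) : Set (X → EReal) := {ρ | ρ ≤ F ρ}

/-- The least solution. -/
noncomputable def leastSol {X : Type*} (F : (X → EReal) → X → EReal) : X → EReal :=
  sInf (solutions F)

/-- The least solution that is greater than or equal to `ρ`. -/
noncomputable def leastSolAbove {X : Type*} (F : (X → EReal) → X → EReal) (ρ : X → EReal) :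
    X → EReal :=
  sInf {τ | ρ ≤ τ ∧ τ ∈ solutions F}

/-! ### Systems of join equations, strategies, improvements -/

/-- A system of equations `x = ⋁ E`, one for each variable `x` in `X`. `Join` is the set of the joins
`⋁ E` that occur on right-hand sides, `rhs x` is the right-hand side of the equation for `x`,
`Alt e` indexes the alternatives that are joined in `e`, and `expr e i` is the meaning of the
alternative `i` as a function of the variable assignment. Variables may or may not share a
right-hand side, so a strategy may be taken to choose per join or (with `Join = X`) per variable. -/
structure JoinSystem.{u, v, w} (X : Type u) where
  Join : Type v
  rhs : X → Join
  rhs_surjective : Function.Surjective rhs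
  Alt : Join → Type w
  expr : (e : Join) → Alt e → (X → EReal) → EReal

namespace JoinSystem

variable {X : Type*}

/-- The operator `⟦E⟧` on variable assignments. -/
noncomputable def sem (E : JoinSystem X) (ρ : X → EReal) : X → EReal :=
  fun x => ⨆ i : E.Alt (E.rhs x), E.expr (E.rhs x) i ρ

/-- A system of concave equations: every join is a join of (at least one) basic concave
expression, that is, of monotone and concave maps. -/
def IsConcave (E : JoinSystem X) : Prop :=
  ∀ e : E.Join, Nonempty (E.Alt e) ∧
    ∀ i : E.Alt e, Monotone (E.expr e i) ∧ IsConcaveMap (E.expr e i)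

/-- The `∨`-strategies: they select an alternative of every join. -/
abbrev Strategy (E : JoinSystem X) : Type _ := (e : E.Join) → E.Alt e

/-- The right-hand sides of the system `E(σ)`. -/
def select (E : JoinSystem X) (σ : E.Strategy) (x : X) : (X → EReal) → EReal :=
  E.expr (E.rhs x) (σ (E.rhs x))

/-- The operator `⟦E(σ)⟧` on variable assignments. -/
def selectSem (E : JoinSystem X) (σ : E.Strategy) (ρ : X → EReal) : X → EReal :=
  fun x => E.select σ x ρ

/-- `σ'` is an improvement of `σ` with respect to `ρ`. -/
def IsImprovement (E : JoinSystem X) (σ σ' : E.Strategy) (ρ : X → EReal) : Prop :=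
  (ρ ∉ solutions E.sem → ρ < E.selectSem σ' ρ) ∧
    ∀ e : E.Join, σ' e ≠ σ e → E.expr e (σ e) ρ < E.expr e (σ' e) ρ

/-- `P` is a `∨`-strategy improvement operator for `E`. -/
def IsImprovementOperator (E : JoinSystem X) (P : E.Strategy → (X → EReal) → E.Strategy) : Prop :=
  ∀ σ ρ, ρ ∈ preSolutions (E.selectSem σ) → E.IsImprovement σ (P σ ρ) ρ

/-- The system `E ∨ -∞`: the alternative `-∞` is added to every join. -/
noncomputable def withBot (E : JoinSystem X) : JoinSystem X where
  Join := E.Join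
  rhs := E.rhs
  rhs_surjective := E.rhs_surjective
  Alt e := Option (E.Alt e)
  expr e i := match i with
    | none => fun _ => ⊥
    | some j => E.expr e j

/-- The strategy improvement algorithm
`σ := σ₀; ρ := ρ₀; while ρ ∉ Sol(E) do { σ := P σ ρ; ρ := μ_{≥ρ}⟦E(σ)⟧ }; return ρ`:
`E.Reaches P σ₀ ρ₀ n σ ρ` says that the loop body is executed at least `n` times and that
`σ` and `ρ` are the values of the program variables after its `n`-th execution. -/
inductive Reaches (E : JoinSystem X) (P : E.Strategy → (X → EReal) → E.Strategy)
    (σ₀ : E.Strategy) (ρ₀ : X → EReal) : ℕ → E.Strategy → (X → EReal) → Prop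
  | init : Reaches E P σ₀ ρ₀ 0 σ₀ ρ₀
  | step (n : ℕ) (σ : E.Strategy) (ρ : X → EReal) :
      Reaches E P σ₀ ρ₀ n σ ρ → ρ ∉ solutions E.sem →
      Reaches E P σ₀ ρ₀ (n + 1) (P σ ρ) (leastSolAbove (E.selectSem (P σ ρ)) ρ)

/-- The algorithm stops after exactly `n` executions of the loop body and returns `ρ`. -/
def Returns (E : JoinSystem X) (P : E.Strategy → (X → EReal) → E.Strategy)
    (σ₀ : E.Strategy) (ρ₀ : X → EReal) (n : ℕ) (ρ : X → EReal) : Prop :=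
  ∃ σ, E.Reaches P σ₀ ρ₀ n σ ρ ∧ ρ ∈ solutions E.sem

end JoinSystem

/-! ### Finite pre-solutions and feasibility of systems `x = F x` of basic equations -/

/-- `ρ` takes only real values. -/
def IsFiniteAssignment {X : Type*} (ρ : X → EReal) : Prop := ∀ x, ⊥ < ρ x ∧ ρ x < ⊤

/-- The operator on assignments of a system `{x = F x}`. -/
def opOf {X : Type*} (F : X → (X → EReal) → EReal) : (X → EReal) → X → EReal :=
  fun ρ x => F x ρ

/-- The finite pre-solutions of a system `{x = F x}`. A variable with the equation `x = -∞` has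
the value `-∞` in every pre-solution; finiteness is required of all the other variables. -/
def finitePreSolutions {X : Type*} (F : X → (X → EReal) → EReal) : Set (X → EReal) :=
  {τ | τ ∈ preSolutions (opOf F) ∧ ∀ x, F x ≠ (fun _ => ⊥) → ⊥ < τ x ∧ τ x < ⊤}

open Classical in
/-- The assignment that agrees with `ρ'` on `S` and with `ρ` elsewhere. -/
noncomputable def glue {X : Type*} (S : Set X) (ρ' ρ : X → EReal) : X → EReal :=
  fun x => if x ∈ S then ρ' x else ρ x

/-- `ρ` is a feasible finite solution. -/
def IsFeasibleFiniteSol {X : Type*} (F : X → (X → EReal) → EReal) (ρ : X → EReal) : Prop :=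
  IsFiniteAssignment ρ ∧ ρ ∈ solutions (opOf F) ∧
    ∃ (X₁ X₂ : Set X) (k : ℕ), X₁ ∪ X₂ = Set.univ ∧ X₁ ∩ X₂ = ∅ ∧
      (∃ ρ' : X → EReal, (∀ x ∈ X₁, ρ' x < ρ x) ∧ glue X₁ ρ' ρ ∈ preSolutions (opOf F) ∧
        ρ = (opOf F)^[k] (glue X₁ ρ' ρ)) ∧
      (∃ ρ' : X → EReal, (∀ x ∈ X₂, ρ' x < ρ x) ∧
        ∀ x ∈ X₂, ρ' x < (opOf F)^[k] (glue X₂ ρ' ρ) x)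

/-- `ρ` is a feasible finite pre-solution. -/
def IsFeasibleFinitePreSol {X : Type*} (F : X → (X → EReal) → EReal) (ρ : X → EReal) : Prop :=
  IsFiniteAssignment ρ ∧ ρ ∈ preSolutions (opOf F) ∧
    IsFeasibleFiniteSol F (leastSolAbove (opOf F) ρ)

open Classical in
/-- The subsystem of the equations for the variables in `S`; the other variables are `-∞`. -/
noncomputable def restrictSystem {X : Type*} (F : X → (X → EReal) → EReal) (S : Set X) :
    S → (S → EReal) → EReal :=
  fun x τ => F x (fun y => if h : y ∈ S then τ ⟨y, h⟩ else ⊥)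

/-- `ρ` is a feasible pre-solution. -/
def IsFeasiblePreSol {X : Type*} (F : X → (X → EReal) → EReal) (ρ : X → EReal) : Prop :=
  ρ ∈ preSolutions (opOf F) ∧ (∀ x, ρ x < ⊤) ∧ (∀ x, F x ρ = ⊥ → F x = fun _ => ⊥) ∧
    IsFeasibleFinitePreSol (restrictSystem F {x | ⊥ < F x ρ})
      (fun x : {x | ⊥ < F x ρ} => ρ x)

/-- The system `{x = F x}` is feasible: it has a feasible solution. -/
def IsFeasibleSystem {X : Type*} (F : X → (X → EReal) → EReal) : Prop :=
  ∃ ρ, ρ ∈ solutions (opOf F) ∧ IsFeasiblePreSol F ρ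

/-!
The proof replaces feasibility by a more flexible invariant. Call a solution `ρ` of `{x = F x}`
*rigid* if only variables with the equation `x = -∞` have the value `-∞`, and if there is no
direction `d ≥ 0`, `d ≠ 0`, supported on the variables with `ρ x ≠ -∞`, such that `ρ - ε d` is a
post-solution (`F (ρ - ε d) ≤ ρ - ε d`) for all small `ε > 0`.

* A rigid solution is the greatest finite pre-solution (`IsRigidSolution.isGreatest`): if `τ` were
  a larger one, then, by concavity along the line through `τ` and `ρ`, all points `ρ - ε (τ - ρ)`
  would be post-solutions.
* Improvement steps preserve rigidity (`IsRigidSolution.leastSolAbove`). Let `ρ'` be the least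
  solution of the new system above `ρ`, and `d` a direction that violates rigidity of `ρ'`. If
  `ρ < ρ'` on the support of `d`, then `ρ' - ε d` is a smaller post-solution above `ρ`, which is
  absurd. Otherwise the equations of the variables in the support at which `ρ` and `ρ'` agree have
  not changed, and the restriction of `d` to these variables violates rigidity of `ρ`.

Hence the values computed by the algorithm are a strictly increasing sequence of greatest finite
pre-solutions below `μ⟦E⟧`. For the bound on the number of steps, a monotone concave map that is
`> -∞` when some variables are `-∞` does not depend on these variables
(`IsConcaveMap.le_maskBot`), because a concave function that is bounded below on a half-line
cannot decrease along it. So a strategy, regarded only on the variables with value `> -∞`, already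
determines their values. Complete every strategy to one of `E` by fixed default alternatives: a
completion can occur again only after a step that is the last one before the set of variables with
value `-∞` shrinks, and there are at most `|X|` such steps (`le_card_add_card_of_stages`).
-/

open Filter Topology

/-! ### Least solutions above a pre-solution -/

section Fixpoints

variable {X : Type*} {F : (X → EReal) → X → EReal} {ρ τ : X → EReal}

theorem leastSolAbove_eq_lfp (hF : Monotone F) (hρ : ρ ≤ F ρ) :
    F (leastSolAbove F ρ) = leastSolAbove F ρ ∧ ρ ≤ leastSolAbove F ρ ∧
      ∀ τ, ρ ≤ τ → F τ ≤ τ → leastSolAbove F ρ ≤ τ := by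
  let G : (X → EReal) →o (X → EReal) := ⟨fun τ => ρ ⊔ F τ, fun a b h => sup_le_sup_left (hF h) _⟩
  have hG : ρ ⊔ F G.lfp = G.lfp := G.map_lfp
  have h1 : ρ ≤ G.lfp := hG ▸ le_sup_left
  have h2 : F G.lfp = G.lfp := by rwa [sup_eq_right.mpr (hρ.trans (hF h1))] at hG
  have h3 : ∀ τ, ρ ≤ τ → F τ ≤ τ → G.lfp ≤ τ := fun τ hτ hFτ => G.lfp_le (sup_le hτ hFτ)
  have h4 : leastSolAbove F ρ = G.lfp :=
    le_antisymm (sInf_le ⟨h1, h2⟩) (le_sInf fun τ hτ => h3 τ hτ.1 (le_of_eq hτ.2))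
  rw [h4]
  exact ⟨h2, h1, h3⟩

theorem map_leastSolAbove (hF : Monotone F) (hρ : ρ ≤ F ρ) :
    F (leastSolAbove F ρ) = leastSolAbove F ρ := (leastSolAbove_eq_lfp hF hρ).1

theorem le_leastSolAbove (hF : Monotone F) (hρ : ρ ≤ F ρ) : ρ ≤ leastSolAbove F ρ :=
  (leastSolAbove_eq_lfp hF hρ).2.1

theorem leastSolAbove_le (hF : Monotone F) (hρ : ρ ≤ F ρ) (hτ : ρ ≤ τ) (hFτ : F τ ≤ τ) :
    leastSolAbove F ρ ≤ τ := (leastSolAbove_eq_lfp hF hρ).2.2 τ hτ hFτ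

theorem leastSol_eq_leastSolAbove_bot : leastSol F = leastSolAbove F ⊥ := by
  simp [leastSol, leastSolAbove]

theorem isLeast_leastSol (hF : Monotone F) : IsLeast (solutions F) (leastSol F) := by
  rw [leastSol_eq_leastSolAbove_bot]
  exact ⟨map_leastSolAbove hF bot_le, fun τ hτ => leastSolAbove_le hF bot_le bot_le (le_of_eq hτ)⟩

end Fixpoints

/-! ### Sections of concave maps -/

section Sections

variable {X : Type*} {f : (X → EReal) → EReal}

open Classical in
/-- The assignment that is `-∞` on `S` and agrees with the real vector `u` elsewhere. -/
noncomputable def maskBot (S : Set X) (u : X → ℝ) : X → EReal :=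
  fun x => if x ∈ S then ⊥ else (u x : EReal)

theorem maskBot_of_mem {S : Set X} {x : X} (h : x ∈ S) (u : X → ℝ) : maskBot S u x = ⊥ := by
  simp [maskBot, h]

theorem maskBot_of_notMem {S : Set X} {x : X} (h : x ∉ S) (u : X → ℝ) :
    maskBot S u x = (u x : EReal) := by
  simp [maskBot, h]

theorem maskBot_toReal {ρ : X → EReal} (hρ : ∀ x, ρ x < ⊤) :
    maskBot {x | ρ x = ⊥} (fun x => (ρ x).toReal) = ρ := by
  funext x
  by_cases h : ρ x = ⊥
  · rw [maskBot_of_mem (by exact h), h]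
  · rw [maskBot_of_notMem (by exact h), EReal.coe_toReal (hρ x).ne h]

open Classical in
theorem IsConcaveMap.concaveOn_maskBot (hf : IsConcaveMap f) (S : Set X) :
    ConcaveOn ℝ {u | f (maskBot S u) ≠ ⊥ ∧ f (maskBot S u) ≠ ⊤}
        (fun u => (f (maskBot S u)).toReal) ∧
      ∀ u v, f (maskBot S u) ≠ ⊥ → f (maskBot S u) ≠ ⊤ → f (maskBot S v) < ⊤ := by
  have key : ∀ u : X → ℝ,
      substArgs f (fun x => if x ∈ S then ArgMode.negInf else ArgMode.ident) (realVec u) =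
        f (maskBot S u) := by
    intro u
    unfold substArgs
    congr 1
    funext x
    by_cases h : x ∈ S <;> simp [h, maskBot, ArgMode.app, realVec]
  have h := hf.2 (fun x => if x ∈ S then ArgMode.negInf else ArgMode.ident)
  simp only [fdom, key] at h
  exact ⟨h.1, fun u v h1 h2 => h.2 ⟨u, h1, h2⟩ v⟩

/-- A monotone concave map that is `> -∞` when the variables in `S` are `-∞` does not grow when
some of them are raised to real values. -/
theorem IsConcaveMap.le_maskBot (hm : Monotone f) (hf : IsConcaveMap f) {S S' : Set X}
    (hS : S' ⊆ S) (w : X → ℝ) (hbot : f (maskBot S w) ≠ ⊥) (htop : f (maskBot S' w) ≠ ⊤) :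
    f (maskBot S' w) ≤ f (maskBot S w) := by
  classical
  let v : ℝ → X → ℝ := fun t x => if x ∈ S then w x - t else w x
  have hv0 : v 0 = w := by funext x; simp [v]
  have hle : ∀ t, maskBot S w ≤ maskBot S' (v t) := by
    intro t x
    by_cases h : x ∈ S
    · rw [maskBot_of_mem h]; exact bot_le
    · rw [maskBot_of_notMem h, maskBot_of_notMem (fun h' => h (hS h'))]
      simp [v, h]
  have hvb : ∀ t, f (maskBot S' (v t)) ≠ ⊥ := fun t h =>
    hbot (le_bot_iff.mp (h ▸ hm (hle t)))
  obtain ⟨hc, hlt⟩ := hf.concaveOn_maskBot S'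
  have hwb : f (maskBot S' w) ≠ ⊥ := hv0 ▸ hvb 0
  have hvt : ∀ t, f (maskBot S' (v t)) ≠ ⊤ := fun t => (hlt w _ hwb htop).ne
  have hbt : f (maskBot S w) ≠ ⊤ := fun h => hvt 0 (top_le_iff.mp (h ▸ hm (hle 0)))
  set b := (f (maskBot S w)).toReal with hb
  set c := (f (maskBot S' w)).toReal with hcdef
  have hbg : ∀ t, b ≤ (f (maskBot S' (v t))).toReal := fun t =>
    EReal.toReal_le_toReal (hm (hle t)) hbot (hvt t)
  -- A concave function of `t ≥ 0` that is bounded below never falls below its value at `0`.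
  have hcg : ∀ t, c ≤ (f (maskBot S' (v t))).toReal := by
    intro t
    have hn : ∀ n : ℕ, c + (b - c) * (1 / ((n : ℝ) + 1)) ≤ (f (maskBot S' (v t))).toReal := by
      intro n
      have hpos : (0 : ℝ) < (n : ℝ) + 1 := by positivity
      have h1 : (1 : ℝ) / ((n : ℝ) + 1) ≤ 1 := by
        rw [div_le_one hpos]; linarith [(Nat.cast_nonneg n : (0 : ℝ) ≤ n)]
      have h0 : (0 : ℝ) ≤ 1 / ((n : ℝ) + 1) := by positivity
      have h := hc.2 (x := w) ⟨hwb, htop⟩ (y := v (((n : ℝ) + 1) * t)) ⟨hvb _, hvt _⟩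
        (sub_nonneg.mpr h1) h0 (by ring)
      have he : (1 - 1 / ((n : ℝ) + 1)) • w + (1 / ((n : ℝ) + 1)) • v (((n : ℝ) + 1) * t)
          = v t := by
        funext x
        by_cases hx : x ∈ S
        · simp only [v, hx, Pi.add_apply, Pi.smul_apply, smul_eq_mul, if_true]
          field_simp
          ring
        · simp only [v, hx, Pi.add_apply, Pi.smul_apply, smul_eq_mul, if_false]
          ring
      rw [he] at h
      simp only [smul_eq_mul] at h
      have h2 := mul_le_mul_of_nonneg_left (hbg (((n : ℝ) + 1) * t)) h0
      rw [← hcdef] at h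
      linarith
    have hlim : Tendsto (fun n : ℕ => c + (b - c) * (1 / ((n : ℝ) + 1))) atTop
        (𝓝 (c + (b - c) * 0)) :=
      (tendsto_one_div_add_atTop_nhds_zero_nat.const_mul _).const_add _
    rw [mul_zero, add_zero] at hlim
    exact le_of_tendsto' hlim hn
  have hlim : Tendsto (fun t : ℝ => maskBot S' (v t)) atTop
      (𝓝[{x | ⊥ < f x}] (maskBot S w)) := by
    refine tendsto_nhdsWithin_iff.mpr
      ⟨tendsto_pi_nhds.mpr fun x => ?_, Eventually.of_forall fun t => bot_lt_iff_ne_bot.mpr (hvb t)⟩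
    by_cases h' : x ∈ S'
    · simp only [maskBot_of_mem h', maskBot_of_mem (hS h')]
      exact tendsto_const_nhds
    · by_cases h : x ∈ S
      · simp only [maskBot_of_notMem h', maskBot_of_mem h, v, h, if_true]
        exact EReal.tendsto_coe_nhds_bot_iff.mpr
          (tendsto_atBot_add_const_left _ _ tendsto_neg_atTop_atBot)
      · simp only [maskBot_of_notMem h', maskBot_of_notMem h, v, h, if_false]
        exact tendsto_const_nhds
  refine ge_of_tendsto' ((hf.1 _ (bot_lt_iff_ne_bot.mpr hbot)).tendsto.comp hlim) fun t => ?_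
  rw [Function.comp_apply, ← EReal.coe_toReal htop hwb, ← EReal.coe_toReal (hvt t) (hvb t)]
  exact EReal.coe_le_coe_iff.mpr (hcg t)

end Sections

/-! ### Rigid solutions -/

section Rigid

variable {X : Type*} {F G H : X → (X → EReal) → EReal} {ρ τ : X → EReal}

/-- The assignment `ρ - ε d`; it keeps the value `-∞`. -/
noncomputable def lowered (ρ : X → EReal) (d : X → ℝ) (ε : ℝ) : X → EReal :=
  fun x => ρ x - ((ε * d x : ℝ) : EReal)

theorem lowered_eq_self_of_eq_zero {d : X → ℝ} {x : X} (h : d x = 0) (ε : ℝ) :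
    lowered ρ d ε x = ρ x := by
  simp [lowered, h]

theorem lowered_le {d : X → ℝ} (hd : 0 ≤ d) {ε : ℝ} (hε : 0 ≤ ε) : lowered ρ d ε ≤ ρ := by
  intro x
  have h : ((0 : ℝ) : EReal) ≤ ((ε * d x : ℝ) : EReal) :=
    EReal.coe_le_coe_iff.mpr (mul_nonneg hε (hd x))
  calc ρ x - ((ε * d x : ℝ) : EReal) ≤ ρ x - ((0 : ℝ) : EReal) := EReal.sub_le_sub le_rfl h
    _ = ρ x := by simp

theorem lowered_maskBot (S : Set X) (u d : X → ℝ) (ε : ℝ) :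
    lowered (maskBot S u) d ε = maskBot S (fun x => u x - ε * d x) := by
  funext x
  by_cases h : x ∈ S
  · simp [lowered, maskBot, h]
  · simp only [lowered, maskBot_of_notMem h, EReal.coe_sub]

theorem eventually_le_lowered {d : X → ℝ} {x : X} {a : EReal} (h : a < ρ x) (ht : ρ x < ⊤) :
    ∀ᶠ ε in 𝓝[>] (0 : ℝ), a ≤ lowered ρ d ε x := by
  have hr : ρ x = ((ρ x).toReal : EReal) := (EReal.coe_toReal ht.ne (bot_le.trans_lt h).ne').symm
  have hlim : Tendsto (fun ε : ℝ => (((ρ x).toReal - ε * d x : ℝ) : EReal)) (𝓝[>] 0)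
      (𝓝 (ρ x)) := by
    have h1 : Continuous fun ε : ℝ => (((ρ x).toReal - ε * d x : ℝ) : EReal) :=
      continuous_coe_real_ereal.comp (by fun_prop)
    have h2 := h1.tendsto 0
    rw [zero_mul, sub_zero, ← hr] at h2
    exact h2.mono_left nhdsWithin_le_nhds
  filter_upwards [hlim.eventually_const_lt h] with ε hε
  rw [lowered, hr, ← EReal.coe_sub]
  exact hε.le

/-- A solution `ρ` of `{x = F x}` is rigid if only the variables with the equation `x = -∞` have
the value `-∞`, and if one cannot descend from `ρ` in a straight line through post-solutions. -/
structure IsRigidSolution (F : X → (X → EReal) → EReal) (ρ : X → EReal) : Prop where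
  sol : opOf F ρ = ρ
  eq_bot : ∀ x, ρ x = ⊥ → F x = fun _ => ⊥
  rigid : ∀ d : X → ℝ, 0 ≤ d → (∀ x, 0 < d x → ρ x ≠ ⊥) → (∃ x, 0 < d x) →
    ¬ ∀ᶠ ε in 𝓝[>] (0 : ℝ), opOf F (lowered ρ d ε) ≤ lowered ρ d ε

theorem monotone_opOf (hF : ∀ x, Monotone (F x)) : Monotone (opOf F) :=
  fun _ _ h x => hF x h

theorem IsRigidSolution.leastSolAbove [Finite X] (h : IsRigidSolution F ρ)
    (hF : ∀ x, Monotone (F x)) (hG : ∀ x, Monotone (G x)) (hρ : ρ ≤ opOf G ρ)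
    (hFG : ∀ x, G x ≠ F x → ρ x < G x ρ) (ht : ∀ x, leastSolAbove (opOf G) ρ x < ⊤) :
    IsRigidSolution G (leastSolAbove (opOf G) ρ) := by
  classical
  have hsol := map_leastSolAbove (monotone_opOf hG) hρ
  have hle := le_leastSolAbove (monotone_opOf hG) hρ
  have hmin := fun τ => leastSolAbove_le (τ := τ) (monotone_opOf hG) hρ
  set ρ' := _root_.leastSolAbove (opOf G) ρ
  have hρ' : ∀ x, G x ρ ≤ ρ' x := fun x => (hG x hle).trans (congrFun hsol x).le
  refine ⟨hsol, fun x hx => ?_, fun d hd hsupp hne hev => ?_⟩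
  · have hρx : ρ x = ⊥ := le_bot_iff.mp (hx ▸ hle x)
    by_contra hGx
    refine absurd (hFG x fun e => hGx (e.trans (h.eq_bot x hρx))) ?_
    have hGx' : G x ρ ≤ ⊥ := (hρ' x).trans hx.le
    rw [hρx]
    exact not_lt.mpr hGx'
  · have hev1 : ∀ᶠ ε in 𝓝[>] (0 : ℝ), ∀ x, ρ x ≠ ρ' x → ρ x ≤ lowered ρ' d ε x := by
      refine eventually_all.mpr fun x => ?_
      by_cases hx : ρ x = ρ' x
      · simp [hx]
      · simpa [hx] using eventually_le_lowered (lt_of_le_of_ne (hle x) hx) (ht x)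
    by_cases hZ : ∃ x, 0 < d x ∧ ρ x = ρ' x
    · -- The part of `d` on the variables that keep their values violates rigidity of `ρ`.
      let dZ : X → ℝ := fun x => if ρ x = ρ' x then d x else 0
      refine h.rigid dZ ?_ ?_ ?_ ?_
      · intro x
        simp only [dZ]
        split_ifs
        · exact hd x
        · exact le_rfl
      · intro x hx
        simp only [dZ] at hx
        split_ifs at hx with h1
        · rw [h1]; exact hsupp x hx
        · exact absurd hx (lt_irrefl _)
      · obtain ⟨x, hx, he⟩ := hZ
        exact ⟨x, by simpa [dZ, he] using hx⟩
      · filter_upwards [hev, hev1, self_mem_nhdsWithin] with ε h1 h2 h3 x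
        have hcmp : lowered ρ dZ ε ≤ lowered ρ' d ε := by
          intro y
          by_cases hy : ρ y = ρ' y
          · simp [lowered, dZ, hy]
          · rw [lowered_eq_self_of_eq_zero (by simp [dZ, hy])]
            exact h2 y hy
        have hdZ : 0 ≤ dZ := by
          intro y
          simp only [dZ]
          split_ifs
          · exact hd y
          · exact le_rfl
        by_cases hx : ρ x = ρ' x
        · -- The equation of a variable whose value does not grow has not changed.
          have hGF : G x = F x := by
            by_contra hn
            exact absurd (hFG x hn) (not_lt.mpr (hx ▸ hρ' x))
          calc F x (lowered ρ dZ ε) ≤ G x (lowered ρ' d ε) := hGF ▸ hG x hcmp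
            _ ≤ lowered ρ' d ε x := h1 x
            _ = lowered ρ dZ ε x := by simp [lowered, dZ, hx]
        · rw [lowered_eq_self_of_eq_zero (by simp [dZ, hx])]
          exact (hF x (lowered_le hdZ (le_of_lt h3))).trans (congrFun h.sol x).le
    · push Not at hZ
      have hev2 : ∀ᶠ ε in 𝓝[>] (0 : ℝ), ρ ≤ lowered ρ' d ε := by
        filter_upwards [hev1] with ε h1 x
        by_cases hx : ρ x = ρ' x
        · have hdx : d x = 0 := le_antisymm (not_lt.mp fun h0 => hZ x h0 hx) (hd x)
          rw [lowered_eq_self_of_eq_zero hdx]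
          exact hle x
        · exact h1 x hx
      obtain ⟨ε, h1, h2, h3⟩ := (hev.and (hev2.and self_mem_nhdsWithin)).exists
      obtain ⟨x, hx⟩ := hne
      have h4 := hmin _ h2 h1 x
      rw [lowered, ← EReal.coe_toReal (ht x).ne (hsupp x hx), ← EReal.coe_sub,
        EReal.coe_le_coe_iff] at h4
      have h5 : 0 < ε * d x := mul_pos h3 hx
      linarith

theorem IsRigidSolution.isGreatest (h : IsRigidSolution F ρ) (hF : ∀ x, Monotone (F x))
    (hc : ∀ x, IsConcaveMap (F x)) (ht : ∀ x, ρ x < ⊤) : IsGreatest (finitePreSolutions F) ρ := by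
  refine ⟨⟨h.sol.ge, fun x hx => ⟨bot_lt_iff_ne_bot.mpr fun h0 => hx (h.eq_bot x h0), ht x⟩⟩, ?_⟩
  intro τ₀ hτ₀
  -- The join `τ` of `ρ` and `τ₀` is again a finite pre-solution.
  let τ := ρ ⊔ τ₀
  have hτ : τ ≤ opOf F τ := sup_le
    (h.sol.ge.trans (monotone_opOf hF le_sup_left))
    (le_trans hτ₀.1 (monotone_opOf hF le_sup_right))
  have hτ₀bot : ∀ x, ρ x = ⊥ → τ₀ x = ⊥ := fun x hx => by
    have h1 : τ₀ x ≤ F x τ₀ := hτ₀.1 x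
    rw [h.eq_bot x hx] at h1
    exact le_bot_iff.mp h1
  have hτbot : ∀ x, τ x = ⊥ ↔ ρ x = ⊥ := fun x =>
    ⟨fun hx => (sup_eq_bot_iff.mp hx).1, fun hx => sup_eq_bot_iff.mpr ⟨hx, hτ₀bot x hx⟩⟩
  have hτt : ∀ x, τ x < ⊤ := fun x => by
    refine max_lt (ht x) ?_
    by_cases hx : F x = fun _ => ⊥
    · have h1 : τ₀ x ≤ F x τ₀ := hτ₀.1 x
      rw [hx] at h1
      exact h1.trans_lt bot_lt_top
    · exact (hτ₀.2 x hx).2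
  set S : Set X := {x | ρ x = ⊥}
  set r : X → ℝ := fun x => (ρ x).toReal
  set t : X → ℝ := fun x => (τ x).toReal
  have hr : maskBot S r = ρ := maskBot_toReal ht
  have hts : maskBot S t = τ := by
    have := maskBot_toReal hτt
    simp only [hτbot] at this
    exact this
  have hrx : ∀ x, x ∉ S → ρ x = (r x : EReal) := fun x hx => by
    rw [← maskBot_of_notMem hx r, hr]
  have htx : ∀ x, x ∉ S → τ x = (t x : EReal) := fun x hx => by
    rw [← maskBot_of_notMem hx t, hts]
  have hrt : ∀ x, r x ≤ t x := fun x => by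
    by_cases hx : x ∈ S
    · simp [r, t, (hτbot x).mpr hx, show ρ x = ⊥ from hx]
    · rw [← EReal.coe_le_coe_iff, ← hrx x hx, ← htx x hx]
      exact le_sup_left (a := ρ x) (b := τ₀ x)
  suffices hle : τ ≤ ρ from le_sup_right.trans hle
  intro x₀
  by_contra hx₀
  have hpos : ∀ x, 0 < t x - r x → ρ x ≠ ⊥ := fun x hx h0 => by
    simp [r, t, (hτbot x).mpr h0, h0] at hx
  refine h.rigid (fun x => t x - r x) (fun x => sub_nonneg.mpr (hrt x)) hpos ⟨x₀, ?_⟩ ?_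
  · have hS : x₀ ∉ S := fun h0 => hx₀ (((hτbot x₀).mpr h0).le.trans bot_le)
    rw [hrx _ hS, htx _ hS, EReal.coe_le_coe_iff] at hx₀
    linarith
  · filter_upwards [self_mem_nhdsWithin] with ε hε x
    have hε0 : (0 : ℝ) < ε := hε
    have hlow : F x (lowered ρ (fun x => t x - r x) ε) ≤ F x ρ :=
      hF x (lowered_le (fun x => sub_nonneg.mpr (hrt x)) hε0.le)
    have hFρ : F x ρ = ρ x := congrFun h.sol x
    by_cases hx : x ∈ S
    · have : F x (lowered ρ (fun x => t x - r x) ε) = ⊥ :=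
        le_bot_iff.mp (hlow.trans (hFρ.trans hx).le)
      exact this.le.trans bot_le
    · show F x _ ≤ _
      rw [← hr, lowered_maskBot] at hlow ⊢
      set z : X → ℝ := fun x => r x - ε * (t x - r x)
      by_cases hz : F x (maskBot S z) = ⊥
      · exact hz.le.trans bot_le
      obtain ⟨hcon, hlt⟩ := (hc x).concaveOn_maskBot S
      have hFr : F x (maskBot S r) = (r x : EReal) := by rw [hr, hFρ, hrx x hx]
      have hzt : F x (maskBot S z) ≠ ⊤ := (hlow.trans_lt (hFr ▸ EReal.coe_lt_top _)).ne
      have hFt : (t x : EReal) ≤ F x (maskBot S t) := by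
        rw [hts, ← htx x hx]; exact hτ x
      have htb : F x (maskBot S t) ≠ ⊥ := (EReal.bot_lt_coe _ |>.trans_le hFt).ne'
      have htt : F x (maskBot S t) ≠ ⊤ := (hlt z t hz hzt).ne
      -- `r` divides the segment from `z` to `t` in the ratio `ε : 1`.
      have hcomb := hcon.2 (x := z) ⟨hz, hzt⟩ (y := t) ⟨htb, htt⟩
        (show 0 ≤ 1 / (1 + ε) by positivity) (show 0 ≤ ε / (1 + ε) by positivity) (by field_simp)
      have he : (1 / (1 + ε)) • z + (ε / (1 + ε)) • t = r := by
        funext y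
        simp only [z, Pi.add_apply, Pi.smul_apply, smul_eq_mul]
        field_simp
        ring
      rw [he] at hcomb
      simp only [hFr, EReal.toReal_coe, smul_eq_mul] at hcomb
      rw [← EReal.coe_toReal htt htb, EReal.coe_le_coe_iff] at hFt
      rw [← EReal.coe_toReal hzt hz, maskBot_of_notMem hx, EReal.coe_le_coe_iff]
      have h1 : (F x (maskBot S z)).toReal + ε * (F x (maskBot S t)).toReal ≤ (1 + ε) * r x := by
        have := mul_le_mul_of_nonneg_left hcomb (by positivity : (0 : ℝ) ≤ 1 + ε)
        calc _ = (1 + ε) * (1 / (1 + ε) * (F x (maskBot S z)).toReal +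
              ε / (1 + ε) * (F x (maskBot S t)).toReal) := by field_simp
          _ ≤ _ := this
      have h2 := mul_le_mul_of_nonneg_left hFt hε0.le
      simp only [z]
      linarith

/-- The values of the variables that are `> -∞` in a rigid solution are determined by the
equations of these variables: a larger solution of any system with the same equations for them
agrees with it there. -/
theorem IsRigidSolution.le_of_agree (h : IsRigidSolution G ρ) (hG : ∀ x, Monotone (G x))
    (hc : ∀ x, IsConcaveMap (G x)) (hle : ρ ≤ τ) (hτ : opOf H τ = τ) (hτt : ∀ x, τ x < ⊤)
    (hGH : ∀ x, ρ x ≠ ⊥ → H x = G x) {x : X} (hx : ρ x ≠ ⊥) : τ x ≤ ρ x := by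
  set S : Set X := {x | ρ x = ⊥}
  set w : X → ℝ := fun x => (τ x).toReal
  have hw : maskBot {x | τ x = ⊥} w = τ := maskBot_toReal hτt
  have hτx : ∀ y, y ∉ S → maskBot S w y = τ y := fun y hy => by
    rw [maskBot_of_notMem hy]
    exact EReal.coe_toReal (hτt y).ne fun h0 => hy (le_bot_iff.mp (h0 ▸ hle y))
  have hρw : ρ ≤ maskBot S w := fun y => by
    by_cases hy : y ∈ S
    · exact (show ρ y = ⊥ from hy).le.trans bot_le
    · rw [hτx y hy]; exact hle y
  have hmem : maskBot S w ∈ finitePreSolutions G := by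
    refine ⟨fun y => ?_, fun y hy => ?_⟩
    · by_cases hy : y ∈ S
      · rw [maskBot_of_mem hy]; exact bot_le
      · have hGτ : G y τ = τ y := by rw [← hGH y hy]; exact congrFun hτ y
        have hGb : G y (maskBot S w) ≠ ⊥ := fun h0 =>
          hy (le_bot_iff.mp (((congrFun h.sol y).symm.le.trans (hG y hρw)).trans h0.le))
        rw [hτx y hy, ← hGτ]
        have := (hc y).le_maskBot (hG y) (S := S) (S' := {x | τ x = ⊥})
          (fun z hz => le_bot_iff.mp (hz ▸ hle z)) w hGb (by rw [hw, hGτ]; exact (hτt y).ne)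
        rwa [hw] at this
    · have hy' : y ∉ S := fun h0 => hy (h.eq_bot y h0)
      rw [maskBot_of_notMem hy']
      exact ⟨EReal.bot_lt_coe _, EReal.coe_lt_top _⟩
  have := (h.isGreatest hG hc fun y => (hle y).trans_lt (hτt y)).2 hmem x
  rwa [hτx x hx] at this

end Rigid

/-! ### Counting steps by stages -/

/-- Suppose that a decreasing sequence of proper subsets `s j` of `X` splits the indices
`1, …, n` into stages, and that a label can occur again only if its first occurrence is the last
index of a stage. Then `n` is at most the number of labels plus `|X|`. -/
theorem le_card_add_card_of_stages {X L : Type*} [Fintype X] [Finite L] (n : ℕ)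
    (s : ℕ → Finset X) (c : ℕ → L) (hs : ∀ j < n, s (j + 1) ⊆ s j)
    (hu : ∀ j, 1 ≤ j → j ≤ n → s j ≠ Finset.univ)
    (hc : ∀ j k, 1 ≤ j → j < k → k ≤ n → s (j + 1) = s j → c j ≠ c k) :
    n ≤ Nat.card L + Fintype.card X := by
  classical
  have := Fintype.ofFinite L
  have hanti : ∀ j k, j ≤ k → k ≤ n → s k ⊆ s j := by
    intro j k hjk
    induction k, hjk using Nat.le_induction with
    | base => exact fun _ => subset_rfl
    | succ k hjk ih => exact fun hk => (hs k hk).trans (ih (by omega))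
  let A := (Finset.Icc 1 n).filter fun j => j < n ∧ s (j + 1) = s j
  let B := (Finset.Icc 1 n).filter fun j => ¬ (j < n ∧ s (j + 1) = s j)
  have hAB : A.card + B.card = n := by
    rw [Finset.card_filter_add_card_filter_not, Nat.card_Icc, Nat.add_sub_cancel]
  have hA : A.card ≤ Nat.card L := by
    rw [Nat.card_eq_fintype_card, ← Finset.card_univ]
    refine Finset.card_le_card_of_injOn c (fun _ _ => Finset.mem_coe.mpr (Finset.mem_univ _)) ?_
    intro j hj k hk hjk
    simp only [A, Finset.coe_filter, Finset.mem_Icc, Set.mem_ofPred_eq] at hj hk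
    rcases lt_trichotomy j k with h | h | h
    · exact absurd hjk (hc j k hj.1.1 h hk.1.2 hj.2.2)
    · exact h
    · exact absurd hjk.symm (hc k j hk.1.1 h hj.1.2 hk.2.2)
  have hB : B.card ≤ Fintype.card X := by
    have hlt : ∀ j ∈ B, ∀ k ∈ B, j < k → (s k).card < (s j).card := by
      intro j hj k hk hjk
      simp only [B, Finset.mem_filter, Finset.mem_Icc] at hj hk
      have hjn : j < n := hjk.trans_le hk.1.2
      have hne : s (j + 1) ≠ s j := fun h => hj.2 ⟨hjn, h⟩
      exact Finset.card_lt_card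
        ((hanti (j + 1) k hjk hk.1.2).trans_ssubset ((hs j hjn).ssubset_of_ne hne))
    rw [← Finset.card_range (Fintype.card X)]
    refine Finset.card_le_card_of_injOn (fun j => (s j).card) ?_ ?_
    · intro j hj
      simp only [B, Finset.coe_filter, Finset.mem_Icc, Set.mem_ofPred_eq] at hj
      rw [Finset.mem_coe, Finset.mem_range, Finset.card_lt_iff_ne_univ]
      exact hu j hj.1.1 hj.1.2
    · intro j hj k hk hjk
      rcases lt_trichotomy j k with h | h | h
      · exact absurd hjk (hlt j hj k hk h).ne'
      · exact h
      · exact absurd hjk (hlt k hk j hj h).ne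
  omega

/-! ### Runs of the algorithm -/

namespace JoinSystem

variable {X : Type*}

theorem IsConcave.withBot {E : JoinSystem X} (hE : E.IsConcave) : E.withBot.IsConcave := by
  refine fun e => ⟨⟨none⟩, fun i => ?_⟩
  cases i with
  | none =>
    refine ⟨monotone_const, continuousOn_const, fun I => ?_⟩
    have h : fdom (substArgs (E.withBot.expr e none) I) = ∅ := by
      ext x
      simp [fdom, substArgs, JoinSystem.withBot]
    rw [h]
    exact ⟨⟨convex_empty, by simp⟩, fun h => absurd h Set.not_nonempty_empty⟩
  | some j => exact (hE e).2 j

theorem sem_withBot (E : JoinSystem X) : E.withBot.sem = E.sem := by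
  funext ρ x
  refine le_antisymm (iSup_le fun i => ?_) (iSup_le fun i => ?_)
  · cases i with
    | none => exact bot_le
    | some j => exact le_iSup (fun i : E.Alt (E.rhs x) => E.expr (E.rhs x) i ρ) j
  · exact le_iSup (fun i : E.withBot.Alt (E.rhs x) => E.withBot.expr (E.rhs x) i ρ) (some i)

theorem IsConcave.monotone_sem {E : JoinSystem X} (hE : E.IsConcave) : Monotone E.sem :=
  fun _ _ h x => iSup_mono fun i => ((hE (E.rhs x)).2 i).1 h

theorem selectSem_le_sem (E : JoinSystem X) (σ : E.Strategy) (ρ : X → EReal) :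
    E.selectSem σ ρ ≤ E.sem ρ :=
  fun x => le_iSup (fun i : E.Alt (E.rhs x) => E.expr (E.rhs x) i ρ) (σ (E.rhs x))

theorem IsConcave.monotone_select {E : JoinSystem X} (hE : E.IsConcave) (σ : E.Strategy) (x : X) :
    Monotone (E.select σ x) := ((hE _).2 _).1

theorem IsConcave.isConcaveMap_select {E : JoinSystem X} (hE : E.IsConcave) (σ : E.Strategy)
    (x : X) : IsConcaveMap (E.select σ x) := ((hE _).2 _).2

theorem IsImprovement.lt_select {E : JoinSystem X} {σ σ' : E.Strategy} {ρ : X → EReal}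
    (h : E.IsImprovement σ σ' ρ) (hρ : E.selectSem σ ρ = ρ) (x : X)
    (hx : E.select σ' x ≠ E.select σ x) : ρ x < E.select σ' x ρ := by
  have h1 : σ' (E.rhs x) ≠ σ (E.rhs x) := fun e => hx (by rw [select, select, e])
  calc ρ x = E.select σ x ρ := (congrFun hρ x).symm
    _ < E.select σ' x ρ := h.2 _ h1

section Run

variable {E : JoinSystem X} {P : E.Strategy → (X → EReal) → E.Strategy} {σ₀ σ : E.Strategy}
  {ρ₀ ρ τ : X → EReal}

theorem lt_leastSolAbove_of_notMem_solutions (hE : E.IsConcave) (hP : E.IsImprovementOperator P)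
    (hρ : E.selectSem σ ρ = ρ) (hns : ρ ∉ solutions E.sem) :
    ρ < leastSolAbove (E.selectSem (P σ ρ)) ρ := by
  have hlt := (hP σ ρ hρ.ge).1 hns
  have hm : Monotone (E.selectSem (P σ ρ)) := monotone_opOf (hE.monotone_select (P σ ρ))
  exact hlt.trans_le ((hm (le_leastSolAbove hm hlt.le)).trans (map_leastSolAbove hm hlt.le).le)

/-- An execution of the loop body preserves rigidity and the property of being below a given solution
`τ < ∞` of the whole system. -/
theorem step_invariant [Finite X] (hE : E.IsConcave) (hP : E.IsImprovementOperator P)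
    (hτ : τ ∈ solutions E.sem) (hτt : ∀ x, τ x < ⊤)
    (hr : IsRigidSolution (E.select σ) ρ) (hle : ρ ≤ τ) (hns : ρ ∉ solutions E.sem) :
    IsRigidSolution (E.select (P σ ρ)) (leastSolAbove (E.selectSem (P σ ρ)) ρ) ∧
      leastSolAbove (E.selectSem (P σ ρ)) ρ ≤ τ := by
  have hsol : E.selectSem σ ρ = ρ := hr.sol
  have himp := hP σ ρ hsol.ge
  have hpre := (himp.1 hns).le
  have hτ' : leastSolAbove (E.selectSem (P σ ρ)) ρ ≤ τ :=
    leastSolAbove_le (monotone_opOf (hE.monotone_select _)) hpre hle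
      ((E.selectSem_le_sem _ τ).trans (le_of_eq hτ))
  exact ⟨hr.leastSolAbove (hE.monotone_select σ) (hE.monotone_select _) hpre
    (himp.lt_select hsol) fun x => (hτ' x).trans_lt (hτt x), hτ'⟩

theorem isRigidSolution_bot (hσ₀ : ∀ x, E.select σ₀ x = fun _ => ⊥) :
    IsRigidSolution (E.select σ₀) ⊥ where
  sol := by funext x; simp [opOf, hσ₀]
  eq_bot x _ := hσ₀ x
  rigid d _ hsupp hne := absurd rfl (hsupp _ hne.choose_spec)

theorem Reaches.invariant [Finite X] (hE : E.IsConcave) (hP : E.IsImprovementOperator P)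
    (hσ₀ : ∀ x, E.select σ₀ x = fun _ => ⊥) (hτ : τ ∈ solutions E.sem) (hτt : ∀ x, τ x < ⊤)
    {n : ℕ} (h : E.Reaches P σ₀ ⊥ n σ ρ) : IsRigidSolution (E.select σ) ρ ∧ ρ ≤ τ := by
  induction h with
  | init => exact ⟨isRigidSolution_bot hσ₀, bot_le⟩
  | step n σ ρ _ hns ih => exact step_invariant hE hP hτ hτt ih.1 ih.2 hns

/-- The values of the program variables after `n` executions of the loop body, if the loop
condition is ignored. -/
noncomputable def run (P : E.Strategy → (X → EReal) → E.Strategy) (σ₀ : E.Strategy)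
    (ρ₀ : X → EReal) : ℕ → E.Strategy × (X → EReal)
  | 0 => (σ₀, ρ₀)
  | n + 1 =>
    (P (run P σ₀ ρ₀ n).1 (run P σ₀ ρ₀ n).2,
      leastSolAbove (E.selectSem (P (run P σ₀ ρ₀ n).1 (run P σ₀ ρ₀ n).2)) (run P σ₀ ρ₀ n).2)

theorem Reaches.eq_run {n : ℕ} (h : E.Reaches P σ₀ ρ₀ n σ ρ) : run P σ₀ ρ₀ n = (σ, ρ) := by
  induction h with
  | init => rfl
  | step n σ ρ _ _ ih => simp [run, ih]

theorem Reaches.reaches_run {n : ℕ} (h : E.Reaches P σ₀ ρ₀ n σ ρ) :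
    ∀ j ≤ n, E.Reaches P σ₀ ρ₀ j (run P σ₀ ρ₀ j).1 (run P σ₀ ρ₀ j).2 ∧
      (j < n → (run P σ₀ ρ₀ j).2 ∉ solutions E.sem) := by
  induction h with
  | init =>
    intro j hj
    obtain rfl := Nat.le_zero.mp hj
    exact ⟨.init, fun h => absurd h (lt_irrefl _)⟩
  | step n σ ρ h hns ih =>
    intro j hj
    rcases hj.lt_or_eq with hj | rfl
    · refine ⟨(ih j (by omega)).1, fun _ => ?_⟩
      rcases (Nat.lt_succ_iff.mp hj).lt_or_eq with hj' | rfl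
      · exact (ih j hj'.le).2 hj'
      · rw [h.eq_run]; exact hns
    · refine ⟨?_, fun h => absurd h (lt_irrefl _)⟩
      rw [(Reaches.step n σ ρ h hns).eq_run]
      exact .step n σ ρ h hns

end Run

/-- The strategy for `E` that replaces the choices of `-∞` by default alternatives. -/
noncomputable def complete {E : JoinSystem X} (hE : E.IsConcave) (σ : E.withBot.Strategy) :
    E.Strategy :=
  fun e => Option.getD (σ e) (Classical.choice (hE e).1)

theorem select_eq_of_complete_eq {E : JoinSystem X} (hE : E.IsConcave)
    {σ σ' : E.withBot.Strategy} (h : complete hE σ = complete hE σ') {x : X} {ρ ρ' : X → EReal}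
    (hσ : E.withBot.select σ x ρ ≠ ⊥) (hσ' : E.withBot.select σ' x ρ' ≠ ⊥) :
    E.withBot.select σ' x = E.withBot.select σ x := by
  have he := congrFun h (E.rhs x)
  have hs : σ (E.rhs x) ≠ none := fun h0 => hσ (by
    have : E.withBot.select σ x = E.withBot.expr (E.rhs x) (σ (E.rhs x)) := rfl
    rw [this, h0]; rfl)
  have hs' : σ' (E.rhs x) ≠ none := fun h0 => hσ' (by
    have : E.withBot.select σ' x = E.withBot.expr (E.rhs x) (σ' (E.rhs x)) := rfl
    rw [this, h0]; rfl)
  obtain ⟨i, hi⟩ := Option.ne_none_iff_exists'.mp hs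
  obtain ⟨i', hi'⟩ := Option.ne_none_iff_exists'.mp hs'
  have hii : i = i' := by
    simp only [complete] at he
    rw [hi, hi'] at he
    exact he
  show E.withBot.expr (E.rhs x) (σ' (E.rhs x)) = E.withBot.expr (E.rhs x) (σ (E.rhs x))
  rw [hi, hi', hii]

theorem Reaches.le_card [Fintype X] {E : JoinSystem X} (hE : E.IsConcave)
    {P : E.withBot.Strategy → (X → EReal) → E.withBot.Strategy}
    (hP : E.withBot.IsImprovementOperator P) {σ₀ σ : E.withBot.Strategy}
    (hσ₀ : ∀ x, E.withBot.select σ₀ x = fun _ => ⊥) {τ ρ : X → EReal}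
    (hτ : τ ∈ solutions E.withBot.sem) (hτt : ∀ x, τ x < ⊤) [Finite E.Strategy] {n : ℕ}
    (h : E.withBot.Reaches P σ₀ ⊥ n σ ρ) : n ≤ Nat.card E.Strategy + Fintype.card X := by
  classical
  have hE' := hE.withBot
  let sg := fun j => (run P σ₀ ⊥ j).1
  let rh := fun j => (run P σ₀ ⊥ j).2
  have hinv : ∀ j ≤ n, IsRigidSolution (E.withBot.select (sg j)) (rh j) ∧ rh j ≤ τ := fun j hj =>
    (h.reaches_run j hj).1.invariant hE' hP hσ₀ hτ hτt
  have hlt : ∀ j < n, rh j < rh (j + 1) := fun j hj =>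
    lt_leastSolAbove_of_notMem_solutions hE' hP (hinv j hj.le).1.sol ((h.reaches_run j hj.le).2 hj)
  have hmono : ∀ j k, j ≤ k → k ≤ n → rh j ≤ rh k := by
    intro j k hjk
    induction k, hjk using Nat.le_induction with
    | base => exact fun _ => le_rfl
    | succ k hjk ih => exact fun hk => (ih (by omega)).trans (hlt k hk).le
  refine le_card_add_card_of_stages n (fun j => Finset.univ.filter fun x => rh j x = ⊥)
    (fun j => complete hE (sg j)) ?_ ?_ ?_
  · intro j hj x hx
    simp only [Finset.mem_filter, Finset.mem_univ, true_and] at hx ⊢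
    exact le_bot_iff.mp (hx ▸ (hlt j hj).le x)
  · intro j h1 hj hu
    obtain ⟨i, rfl⟩ : ∃ i, j = i + 1 := ⟨j - 1, by omega⟩
    refine (bot_le.trans_lt (hlt i hj)).ne' ?_
    funext x
    have hx := Finset.mem_univ x
    rw [← hu] at hx
    exact (Finset.mem_filter.mp hx).2
  · intro j k _ hjk hk hs heq
    have hjn : j < n := hjk.trans_le hk
    have hrj := (hinv j hjn.le).1
    have hrk := (hinv k hk).1
    have hjk' := hmono j k hjk.le hk
    -- The values that are `> -∞` after step `j` can no longer grow.
    have hfix : ∀ x, rh j x ≠ ⊥ → rh k x ≤ rh j x := fun x hx =>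
      hrj.le_of_agree (hE'.monotone_select _) (hE'.isConcaveMap_select _) hjk' hrk.sol
        (fun y => ((hinv k hk).2 y).trans_lt (hτt y))
        (fun y hy => select_eq_of_complete_eq hE heq (ρ := rh j) (ρ' := rh k)
          (fun h0 => hy ((congrFun hrj.sol y).symm.trans h0))
          (fun h0 => hy (le_bot_iff.mp
            ((hjk' y).trans ((congrFun hrk.sol y).symm.trans h0).le)))) hx
    refine (hlt j hjn).not_ge fun x => ?_
    by_cases hx : rh j x = ⊥
    · have : x ∈ Finset.univ.filter fun x => rh (j + 1) x = ⊥ := by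
        rw [hs]; simpa using hx
      rw [(Finset.mem_filter.mp this).2]
      exact bot_le
    · exact (hmono (j + 1) k hjk hk x).trans (hfix x hx)

end JoinSystem

/-! ### The strategy improvement algorithm -/

theorem theorem2 {X : Type*} [Fintype X] (E : JoinSystem X) (hE : E.IsConcave)
    (hμ : ∀ x, leastSol E.sem x < ⊤)
    -- a strategy improvement operator for `E ∨ -∞`
    (P : E.withBot.Strategy → (X → EReal) → E.withBot.Strategy)
    (hP : E.withBot.IsImprovementOperator P)
    -- the initial strategy, which selects `-∞` everywhere; the initial assignment is `-∞`
    (σ₀ : E.withBot.Strategy) (hσ₀ : ∀ x, E.withBot.select σ₀ x = fun _ => ⊥)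
    -- a procedure for the greatest finite pre-solutions of the feasible systems
    (gfps : E.withBot.Strategy → (X → EReal))
    (hgfps : ∀ σ, IsFeasibleSystem (E.withBot.select σ) →
      ∀ τ, IsGreatest (finitePreSolutions (E.withBot.select σ)) τ → gfps σ = τ) :
    -- `μ⟦E⟧` is the least solution, and the algorithm can return nothing else
    (IsLeast (solutions E.sem) (leastSol E.sem) ∧
      ∀ n ρ, E.withBot.Returns P σ₀ ⊥ n ρ → ρ = leastSol E.sem) ∧
    -- it performs at most `|Σ| + |X|` improvement steps
    (∀ n σ ρ, E.withBot.Reaches P σ₀ ⊥ n σ ρ →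
      (n : ℕ∞) ≤ ENat.card E.Strategy + (Fintype.card X : ℕ∞)) ∧
    -- if there are finitely many strategies, it terminates and returns `μ⟦E⟧`
    (Finite E.Strategy → ∃ n : ℕ, E.withBot.Returns P σ₀ ⊥ n (leastSol E.sem) ∧
      n ≤ Nat.card E.Strategy + Fintype.card X) ∧
    -- every evaluation step is well defined and amounts to computing a greatest finite
    -- pre-solution; for a feasible system the given procedure returns the result
    (∀ n σ ρ, E.withBot.Reaches P σ₀ ⊥ n σ ρ → ρ ∉ solutions E.withBot.sem →
      IsLeast {τ | ρ ≤ τ ∧ τ ∈ solutions (E.withBot.selectSem (P σ ρ))}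
        (leastSolAbove (E.withBot.selectSem (P σ ρ)) ρ) ∧
      IsGreatest (finitePreSolutions (E.withBot.select (P σ ρ)))
        (leastSolAbove (E.withBot.selectSem (P σ ρ)) ρ) ∧
      (IsFeasibleSystem (E.withBot.select (P σ ρ)) →
        leastSolAbove (E.withBot.selectSem (P σ ρ)) ρ = gfps (P σ ρ))) := by
  have hE' := hE.withBot
  have hleast := isLeast_leastSol hE.monotone_sem
  have hsolμ : leastSol E.sem ∈ solutions E.withBot.sem := E.sem_withBot ▸ hleast.1
  have hinv := fun {n σ ρ} (h : E.withBot.Reaches P σ₀ ⊥ n σ ρ) =>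
    h.invariant hE' hP hσ₀ hsolμ hμ
  have hret : ∀ n ρ, E.withBot.Returns P σ₀ ⊥ n ρ → ρ = leastSol E.sem := by
    rintro n ρ ⟨σ, hr, hs⟩
    rw [E.sem_withBot] at hs
    exact le_antisymm (hinv hr).2 (hleast.2 hs)
  refine ⟨⟨hleast, hret⟩, fun n σ ρ h => ?_, fun hfin => ?_, fun n σ ρ h hns => ?_⟩
  · rcases finite_or_infinite E.Strategy with hfin | hinf
    · rw [ENat.card_eq_coe_natCard]
      exact_mod_cast h.le_card hE hP hσ₀ hsolμ hμ
    · simp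
  · by_cases hex : ∃ n ρ, E.withBot.Returns P σ₀ ⊥ n ρ
    · obtain ⟨n, ρ, hr⟩ := hex
      refine ⟨n, hret n ρ hr ▸ hr, ?_⟩
      obtain ⟨σ, h, -⟩ := hr
      exact h.le_card hE hP hσ₀ hsolμ hμ
    · -- A run that never stops would exceed the bound on the number of steps.
      exfalso
      have hall : ∀ n, ∃ σ ρ, E.withBot.Reaches P σ₀ ⊥ n σ ρ := by
        intro n
        induction n with
        | zero => exact ⟨_, _, .init⟩
        | succ n ih =>
          obtain ⟨σ, ρ, h⟩ := ih
          exact ⟨_, _, .step n σ ρ h fun hs => hex ⟨n, ρ, σ, h, hs⟩⟩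
      obtain ⟨σ, ρ, h⟩ := hall (Nat.card E.Strategy + Fintype.card X + 1)
      have := h.le_card hE hP hσ₀ hsolμ hμ
      omega
  · have hr := hinv h
    have hpre := ((hP σ ρ hr.1.sol.ge).1 hns).le
    have hm : Monotone (E.withBot.selectSem (P σ ρ)) := monotone_opOf (hE'.monotone_select _)
    have hstep := JoinSystem.step_invariant hE' hP hsolμ hμ hr.1 hr.2 hns
    have hg := hstep.1.isGreatest (hE'.monotone_select _) (hE'.isConcaveMap_select _)
      fun x => (hstep.2 x).trans_lt (hμ x)
    exact ⟨⟨⟨le_leastSolAbove hm hpre, map_leastSolAbove hm hpre⟩,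
      fun τ hτ => leastSolAbove_le hm hpre hτ.1 (le_of_eq hτ.2)⟩, hg,
      fun hf => (hgfps _ hf _ hg).symm⟩
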